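/- Call a hypergraph a pair $(V,E)$ with $V$ a finite set of vertices and $E$ a family of subsets of $V$, the hyperedges. It is $n$-uniform if every hyperedge has exactly $n$ elements. The degree of a vertex is the number of hyperedges that contain it, and the maximum degree is the largest degree of a vertex. In the Maker/Breaker game on a hypergraph, Maker and Breaker take turns, Maker going first, in claiming one previously unclaimed vertex, until all vertices are claimed. Maker wins if he claims all vertices of some hyperedge; otherwise Breaker wins. A pairing strategy of Maker is a strategy of the following kind: after Maker has claimed his first vertex, all but at most one of the remaining vertices are divided into pairs, and whenever Breaker claims a vertex of a pair whose other vertex is still unclaimed, Maker claims that other vertex (all other moves of Maker may be any unclaimed vertices). Theorem. There is an $n_0$ such that for every $n\ge n_0$ that is a power of $2$ there is an $n$-uniform hypergraph with maximum degree exactly $\frac{2^{n-1}}{n}$ on which Maker has a winning pairing strategy, i.e. a pairing strategy with which he wins against every play of Breaker. -/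

import Mathlib

/-! ### Uniformity and degrees of a hypergraph -/

/-- `H` is `n`-uniform: every hyperedge has exactly `n` vertices. -/
def Hypergraph.IsUniform {V : Type*} (H : Hypergraph V) (n : ℕ) : Prop :=
  ∀ e ∈ H.edgeSet, e.Finite ∧ e.ncard = n

/-- The degree of `v`: the number of hyperedges containing `v`. -/
noncomputable def Hypergraph.degree {V : Type*} (H : Hypergraph V) (v : V) : ℕ :=
  {e | e ∈ H.edgeSet ∧ v ∈ e}.ncard

/-- `d` is the maximum degree of `H`: it is attained by a vertex of `H`, and no vertex of `H` has a
larger degree. -/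
def Hypergraph.HasMaxDegree {V : Type*} (H : Hypergraph V) (d : ℕ) : Prop :=
  IsGreatest (H.degree '' H.vertexSet) d

/-! ### The Maker/Breaker game on a hypergraph

The course of the game is the list of the claimed vertices, in the order in which they are claimed.
Maker goes first, so Maker's moves are those with an even index `0, 2, 4, …`, and Maker is to move
exactly when the length of the list is even. -/

namespace MakerBreaker

/-- A course of the game (possibly unfinished): a list of vertices of `H`, none claimed twice. -/
def IsCourse {V : Type*} (H : Hypergraph V) (h : List V) : Prop :=
  h.Nodup ∧ ∀ v ∈ h, v ∈ H.vertexSet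

/-- A complete play: every vertex of `H` has been claimed. -/
def IsCompletePlay {V : Type*} (H : Hypergraph V) (p : List V) : Prop :=
  IsCourse H p ∧ ∀ v ∈ H.vertexSet, v ∈ p

/-- The vertices claimed by Maker. -/
def makerVertices {V : Type*} (h : List V) : Set V :=
  {v | ∃ i : ℕ, h[2 * i]? = some v}

/-- Maker wins the play `p` if Maker has claimed all vertices of some hyperedge. -/
def MakerWins {V : Type*} (H : Hypergraph V) (p : List V) : Prop :=
  ∃ e ∈ H.edgeSet, e ⊆ makerVertices p

/-- A strategy of Maker: whenever it is Maker's turn and an unclaimed vertex is left, it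
names an unclaimed vertex (which may depend on the whole course so far). -/
structure MakerStrategy {V : Type*} (H : Hypergraph V) where
  /-- The vertex that Maker claims next. -/
  move : List V → V
  /-- Maker's moves are legal. -/
  legal : ∀ h : List V, IsCourse H h → Even h.length → (∃ v ∈ H.vertexSet, v ∉ h) →
    move h ∈ H.vertexSet ∧ move h ∉ h

namespace MakerStrategy

/-- In the course `p` Maker has played according to `σ`; Breaker's moves are arbitrary. -/
def Follows {V : Type*} {H : Hypergraph V} (σ : MakerStrategy H) (p : List V) : Prop :=
  ∀ (i : ℕ) (hi : 2 * i < p.length), p[2 * i] = σ.move (p.take (2 * i))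

/-- `σ` is a winning strategy: Maker wins every complete play in which he follows `σ`. -/
def IsWinning {V : Type*} {H : Hypergraph V} (σ : MakerStrategy H) : Prop :=
  ∀ p : List V, IsCompletePlay H p → σ.Follows p → MakerWins H p

/-- `σ` is a pairing strategy. Let `σ.move []` be the first vertex that Maker claims. There is a
division of all but at most one of the remaining vertices into pairs such that, whenever Breaker
has just claimed a vertex `b` of a pair whose other vertex is still unclaimed, Maker takes that
other vertex. The division is given by the involution `mate` of the vertex set that exchanges the
two vertices of every pair and fixes the vertices that are in no pair. -/
def IsPairing {V : Type*} {H : Hypergraph V} (σ : MakerStrategy H) : Prop :=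
  ∃ mate : V → V,
    (∀ v ∈ H.vertexSet, mate v ∈ H.vertexSet ∧ mate (mate v) = v) ∧
    mate (σ.move []) = σ.move [] ∧
    {v | v ∈ H.vertexSet ∧ v ≠ σ.move [] ∧ mate v = v}.Subsingleton ∧
    ∀ (h : List V) (b : V), IsCourse H (h ++ [b]) → Even (h ++ [b]).length →
      mate b ∉ h ++ [b] → σ.move (h ++ [b]) = mate b

end MakerStrategy

/-- Maker has a winning pairing strategy on `H`. -/
def HasWinningPairingStrategy {V : Type*} (H : Hypergraph V) : Prop :=
  ∃ σ : MakerStrategy H, σ.IsPairing ∧ σ.IsWinning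

end MakerBreaker

/-! Take a full binary tree all of whose leaves have depth at least n, let its nodes be the
vertices, and make the last n nodes on the path to each leaf a hyperedge. Maker takes the root and
answers with siblings, so he gets a node of every sibling pair and hence a whole path from the root
to a leaf. The degree of a node is at most the number of leaves within distance n - 1 below it, so
it suffices that this number is at most d = 2^(n-1)/n at every node (`exists_isSparse`). Further
n-sets then raise the maximum degree to exactly d.

The tree is built from the root down, keeping track of how many leaves a node may have at each
distance: U j * 2^(k-j) / c at distance k - j, where k = n - 1 and c = 2n. Sparsity at the node
reads ∑ U j / 2^j ≤ 2, and by Kraft's inequality the tree can be finished once ∑ U j is slightly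
larger than c. Even splitting, with fresh leaves of density 1 at distance k, only reaches U = 1,
about half of that weight. The gain comes from uneven splitting (`AdmitsDensity.of_round`): the
leaves nearest to the node go to a few descendants, which Kraft's inequality finishes, and the other
descendants share the remaining leaves at higher density. Thirteen such rounds suffice
(`AdmitsDensity.zero`). -/

/-! ### Binary trees with few leaves near every node -/

/-- Full binary trees: every node has no or exactly two children. -/
inductive FullBinTree
  | leaf : FullBinTree
  | node (l r : FullBinTree) : FullBinTree

namespace FullBinTree

/-- The number of leaves at distance `i` from the root. -/
def leafCount : FullBinTree → ℕ → ℕ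
  | leaf, 0 => 1
  | leaf, _ + 1 => 0
  | node _ _, 0 => 0
  | node l r, i + 1 => leafCount l i + leafCount r i

/-- Every node has at most `d` leaves below it within distance `k`. -/
def IsSparse (k d : ℕ) : FullBinTree → Prop
  | leaf => 1 ≤ d
  | node l r => ∑ i ∈ Finset.range (k + 1), leafCount (node l r) i ≤ d ∧
      IsSparse k d l ∧ IsSparse k d r

/-- Some sparse tree has at most `x i` leaves at every distance `i ≤ k` from its root. -/
def Admits (k d : ℕ) (x : ℕ → ℕ) : Prop :=
  ∃ T : FullBinTree, T.IsSparse k d ∧ ∀ i ≤ k, T.leafCount i ≤ x i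

lemma Admits.mono {k d : ℕ} {x y : ℕ → ℕ} (h : Admits k d x) (hxy : ∀ i ≤ k, x i ≤ y i) :
    Admits k d y := by
  obtain ⟨T, hT, hx⟩ := h
  exact ⟨T, hT, fun i hi => (hx i hi).trans (hxy i hi)⟩

lemma Admits.of_leaf {k d : ℕ} {x : ℕ → ℕ} (hd : 1 ≤ d) (hx : 1 ≤ x 0) : Admits k d x := by
  refine ⟨leaf, hd, fun i _ => ?_⟩
  cases i with
  | zero => exact hx
  | succ i => exact Nat.zero_le _

/-- Only `i < k` matters in `h`: leaves at distance `k` from a child are out of the parent's reach.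
-/
lemma Admits.of_node {k d : ℕ} {x y z : ℕ → ℕ} (hx : ∑ i ∈ Finset.range (k + 1), x i ≤ d)
    (hy : Admits k d y) (hz : Admits k d z) (h : ∀ i < k, y i + z i ≤ x (i + 1)) :
    Admits k d x := by
  obtain ⟨l, hl, hly⟩ := hy
  obtain ⟨r, hr, hrz⟩ := hz
  have key : ∀ i ≤ k, (node l r).leafCount i ≤ x i := by
    intro i hi
    cases i with
    | zero => exact Nat.zero_le _
    | succ i =>
      exact (Nat.add_le_add (hly i (by omega)) (hrz i (by omega))).trans (h i (by omega))
  refine ⟨node l r, ⟨le_trans (Finset.sum_le_sum fun i hi => key i ?_) hx, hl, hr⟩, key⟩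
  have := Finset.mem_range.1 hi
  omega

/-- A leaf profile of weight at least `1` dominates one of weight exactly `1`. -/
lemma exists_le_sum_eq_two_pow (K : ℕ) (y : ℕ → ℕ)
    (h : 2 ^ K ≤ ∑ i ∈ Finset.range (K + 1), y i * 2 ^ (K - i)) :
    ∃ z : ℕ → ℕ, (∀ i, z i ≤ y i) ∧
      ∑ i ∈ Finset.range (K + 1), z i * 2 ^ (K - i) = 2 ^ K := by
  induction K with
  | zero =>
    refine ⟨fun i => if i = 0 then 1 else 0, fun i => ?_, by simp⟩
    simp only [zero_add, Finset.range_one, Finset.sum_singleton] at h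
    by_cases hi : i = 0
    · subst hi; simpa using h
    · simp [hi]
  | succ K ih =>
    have hdouble : ∀ w : ℕ → ℕ, ∑ i ∈ Finset.range (K + 1), w i * 2 ^ (K + 1 - i)
        = 2 * ∑ i ∈ Finset.range (K + 1), w i * 2 ^ (K - i) := by
      intro w
      rw [Finset.mul_sum]
      refine Finset.sum_congr rfl fun i hi => ?_
      have := Finset.mem_range.1 hi
      rw [show K + 1 - i = (K - i) + 1 by omega, pow_succ]
      ring
    rw [Finset.sum_range_succ, hdouble] at h
    simp only [Nat.sub_self, pow_zero, mul_one] at h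
    by_cases hK : 2 ^ K ≤ ∑ i ∈ Finset.range (K + 1), y i * 2 ^ (K - i)
    · obtain ⟨z, hzy, hz⟩ := ih hK
      refine ⟨fun i => if i ≤ K then z i else 0, fun i => ?_, ?_⟩
      · dsimp only
        split_ifs
        · exact hzy i
        · exact Nat.zero_le _
      · rw [Finset.sum_range_succ, hdouble]
        have : ∑ i ∈ Finset.range (K + 1), (if i ≤ K then z i else 0) * 2 ^ (K - i) = 2 ^ K := by
          rw [← hz]
          refine Finset.sum_congr rfl fun i hi => ?_
          have := Finset.mem_range.1 hi
          rw [if_pos (by omega)]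
        rw [this]
        simp [pow_succ, mul_comm]
    -- The levels up to `K` fall short of the total: take them all and fill up with leaves of the
    -- last level, which have weight 1 each.
    · push Not at hK
      set S := ∑ i ∈ Finset.range (K + 1), y i * 2 ^ (K - i) with hS
      refine ⟨fun i => if i ≤ K then y i else if i = K + 1 then 2 ^ (K + 1) - 2 * S else 0,
        fun i => ?_, ?_⟩
      · dsimp only
        split_ifs with h1 h2
        · exact le_rfl
        · subst h2; omega
        · exact Nat.zero_le _
      · rw [Finset.sum_range_succ, hdouble]
        have : ∑ i ∈ Finset.range (K + 1),
            (if i ≤ K then y i else if i = K + 1 then 2 ^ (K + 1) - 2 * S else 0) * 2 ^ (K - i)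
            = S := by
          refine Finset.sum_congr rfl fun i hi => ?_
          have := Finset.mem_range.1 hi
          rw [if_pos (by omega)]
        rw [this]
        have hpow : 2 ^ (K + 1) = 2 * 2 ^ K := by rw [pow_succ]; ring
        simp only [Nat.sub_self, pow_zero, mul_one, if_false, if_true,
          add_le_iff_nonpos_right, nonpos_iff_eq_zero, one_ne_zero]
        omega

/-- A profile whose weight is at least `1` is realized by a sparse tree (Kraft's inequality). -/
lemma Admits.of_kraft {k d : ℕ} (K : ℕ) (hK : K ≤ k) (x : ℕ → ℕ)
    (hx : ∑ i ∈ Finset.range (k + 1), x i ≤ d)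
    (h : 2 ^ K ≤ ∑ i ∈ Finset.range (K + 1), x i * 2 ^ (K - i)) : Admits k d x := by
  induction K generalizing x with
  | zero =>
    simp only [zero_add, Finset.range_one, Finset.sum_singleton, pow_zero, Nat.sub_self,
      mul_one] at h
    refine Admits.of_leaf (h.trans (le_trans ?_ hx)) h
    exact Finset.single_le_sum (f := x) (fun _ _ => Nat.zero_le _) (Finset.mem_range.2 (by omega))
  | succ K ih =>
    by_cases h0 : 1 ≤ x 0
    · refine Admits.of_leaf (h0.trans (le_trans ?_ hx)) h0
      exact Finset.single_le_sum (f := x) (fun _ _ => Nat.zero_le _)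
        (Finset.mem_range.2 (by omega))
    have h0 : x 0 = 0 := by omega
    have hshift : ∑ i ∈ Finset.range (K + 1 + 1), x i * 2 ^ (K + 1 - i)
        = ∑ i ∈ Finset.range (K + 1), x (i + 1) * 2 ^ (K - i) := by
      rw [Finset.sum_range_succ', h0]
      simp only [zero_mul, add_zero, Nat.add_sub_add_right]
    rw [hshift] at h
    -- One child gets a part `z` of weight exactly `2 ^ K`; at least as much is left for the other.
    obtain ⟨z, hzy, hz⟩ := exists_le_sum_eq_two_pow K (fun i => x (i + 1))
      (le_trans (Nat.pow_le_pow_right (by norm_num) (by omega)) h)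
    -- The cut-off at `k` discards `x (k + 1)`, which `hx` does not control.
    have hsum : ∀ w : ℕ → ℕ, (∀ i, w i ≤ x (i + 1)) →
        ∑ i ∈ Finset.range (k + 1), (if i < k then w i else 0) ≤ d := by
      intro w hw
      rw [Finset.sum_range_succ, if_neg (lt_irrefl k), add_zero]
      rw [Finset.sum_range_succ', h0, add_zero] at hx
      refine le_trans (Finset.sum_le_sum fun i _ => ?_) hx
      split_ifs
      · exact hw i
      · exact Nat.zero_le _
    have hif : ∀ w : ℕ → ℕ, ∑ i ∈ Finset.range (K + 1), (if i < k then w i else 0) * 2 ^ (K - i)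
        = ∑ i ∈ Finset.range (K + 1), w i * 2 ^ (K - i) := by
      intro w
      refine Finset.sum_congr rfl fun i hi => ?_
      have := Finset.mem_range.1 hi
      rw [if_pos (by omega)]
    refine Admits.of_node hx (ih (by omega) (fun i => if i < k then z i else 0) (hsum z hzy) ?_)
      (ih (by omega) (fun i => if i < k then x (i + 1) - z i else 0)
        (hsum (fun i => x (i + 1) - z i) fun i => Nat.sub_le _ _) ?_) ?_
    · rw [hif, hz]
    · rw [hif (fun i => x (i + 1) - z i)]
      have : ∑ i ∈ Finset.range (K + 1), (x (i + 1) - z i) * 2 ^ (K - i)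
          + ∑ i ∈ Finset.range (K + 1), z i * 2 ^ (K - i)
          = ∑ i ∈ Finset.range (K + 1), x (i + 1) * 2 ^ (K - i) := by
        rw [← Finset.sum_add_distrib]
        refine Finset.sum_congr rfl fun i _ => ?_
        rw [← add_mul, Nat.sub_add_cancel (hzy i)]
      rw [pow_succ] at h
      omega
    · intro i hi
      have := hzy i
      rw [if_pos hi, if_pos hi]
      omega

/-! ### Leaf densities

A leaf profile `x` is described by the density `U`, where `x (k - j) = ⌊U j * 2 ^ (k - j) / c⌋`. -/

/-- The leaf profile of the density `U` is admitted. -/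
def AdmitsDensity (k d : ℕ) (c : ℝ) (U : ℕ → ℝ) : Prop :=
  Admits k d fun i => ⌊U (k - i) * 2 ^ i / c⌋₊

variable {k d : ℕ} {c : ℝ} {U V W : ℕ → ℝ}

lemma AdmitsDensity.mono (hc : 0 < c) (h : AdmitsDensity k d c U) (hUV : ∀ j, U j ≤ V j) :
    AdmitsDensity k d c V :=
  Admits.mono h fun i _ => Nat.floor_le_floor (by gcongr; exact hUV _)

/-- Turns sparsity at a node into a bound on the cost `∑ U j / 2 ^ j`, whose unit is `2 ^ k / c`
leaves. -/
lemma sum_floor_le (hc : 0 < c) (hcd : 2 * 2 ^ k ≤ c * d) (hU : ∀ j, 0 ≤ U j)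
    (hcost : ∑ j ∈ Finset.range (k + 1), U j / 2 ^ j ≤ 2) :
    ∑ i ∈ Finset.range (k + 1), ⌊U (k - i) * 2 ^ i / c⌋₊ ≤ d := by
  have h : ∑ i ∈ Finset.range (k + 1), (⌊U (k - i) * 2 ^ i / c⌋₊ : ℝ)
      ≤ ∑ i ∈ Finset.range (k + 1), U (k - i) * 2 ^ i / c :=
    Finset.sum_le_sum fun i _ => Nat.floor_le (div_nonneg (mul_nonneg (hU _) (by positivity)) hc.le)
  have h2 : ∑ i ∈ Finset.range (k + 1), U (k - i) * 2 ^ i / c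
      = 2 ^ k / c * ∑ j ∈ Finset.range (k + 1), U j / 2 ^ j := by
    rw [← Finset.sum_range_reflect (fun j => U j / 2 ^ j), Finset.mul_sum]
    refine Finset.sum_congr rfl fun i hi => ?_
    have hi := Finset.mem_range.1 hi
    rw [show k + 1 - 1 - i = k - i by omega]
    have : (2 : ℝ) ^ k = 2 ^ i * 2 ^ (k - i) := by rw [← pow_add]; congr 1; omega
    rw [this]
    field_simp
  have h3 : 2 ^ k / c * ∑ j ∈ Finset.range (k + 1), U j / 2 ^ j ≤ 2 ^ k / c * 2 := by gcongr
  have h4 : 2 ^ k / c * 2 ≤ (d : ℝ) := by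
    rw [div_mul_eq_mul_div, div_le_iff₀ hc]
    linarith
  rw [h2] at h
  exact_mod_cast h.trans (h3.trans h4)

/-- Distance `k - j` from the parent is distance `k - (j + 1)` from the child, where the unit of
density is half as large; hence the shift and the factor 2. The values `V 0` and `W 0` are free,
which is how new leaves enter. -/
lemma AdmitsDensity.of_split (hc : 0 < c) (hcd : 2 * 2 ^ k ≤ c * d) (hU : ∀ j, 0 ≤ U j)
    (hcost : ∑ j ∈ Finset.range (k + 1), U j / 2 ^ j ≤ 2) (hV0 : ∀ j, 0 ≤ V j)
    (hW0 : ∀ j, 0 ≤ W j) (hV : AdmitsDensity k d c V) (hW : AdmitsDensity k d c W)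
    (h : ∀ j, V (j + 1) + W (j + 1) ≤ 2 * U j) : AdmitsDensity k d c U := by
  refine Admits.of_node (sum_floor_le hc hcd hU hcost) hV hW fun i hi => ?_
  obtain ⟨j, rfl⟩ : ∃ j, k = i + 1 + j := ⟨k - (i + 1), by omega⟩
  have h1 : i + 1 + j - i = j + 1 := by omega
  have h2 : i + 1 + j - (i + 1) = j := by omega
  simp only [h1, h2]
  refine (Nat.le_floor (a := V (j + 1) * 2 ^ i / c + W (j + 1) * 2 ^ i / c) ?_).trans
    (Nat.floor_le_floor ?_)
  · push_cast
    exact add_le_add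
      (Nat.floor_le (div_nonneg (mul_nonneg (hV0 _) (by positivity)) hc.le))
      (Nat.floor_le (div_nonneg (mul_nonneg (hW0 _) (by positivity)) hc.le))
  · rw [← add_div, ← add_mul, pow_succ', ← mul_assoc]
    gcongr
    linarith [h j]

/-- Level `j` contributes `U j / c` to Kraft's sum, and rounding loses at most `2 ^ j / 2 ^ k` of
it. Over `j ≤ m` the loss is at most `2 / 2 ^ s`, which the extra factor pays for. -/
lemma AdmitsDensity.of_weight (hc : 0 < c) (hcd : 2 * 2 ^ k ≤ c * d) (hU : ∀ j, 0 ≤ U j)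
    (hcost : ∑ j ∈ Finset.range (k + 1), U j / 2 ^ j ≤ 2) (m s : ℕ) (hk : k = m + s)
    (hw : c * (1 + 2 / 2 ^ s) ≤ ∑ j ∈ Finset.range (m + 1), U j) : AdmitsDensity k d c U := by
  refine Admits.of_kraft k le_rfl _ (sum_floor_le hc hcd hU hcost) ?_
  rw [← Finset.sum_range_reflect]
  have hterm : ∀ j ∈ Finset.range (m + 1), 2 ^ k / c * U j - 2 ^ j ≤
      (⌊U (k - (k + 1 - 1 - j)) * 2 ^ (k + 1 - 1 - j) / c⌋₊ : ℝ) * 2 ^ (k - (k + 1 - 1 - j)) := by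
    intro j hj
    have hj := Finset.mem_range.1 hj
    have h1 : k + 1 - 1 - j = k - j := by omega
    have h2 : k - (k - j) = j := by omega
    rw [h1, h2]
    have hfl := Nat.lt_floor_add_one (U j * 2 ^ (k - j) / c)
    have hk : (2 : ℝ) ^ k = 2 ^ (k - j) * 2 ^ j := by rw [← pow_add]; congr 1; omega
    have : 2 ^ k / c * U j - 2 ^ j = (U j * 2 ^ (k - j) / c - 1) * 2 ^ j := by
      rw [hk]; field_simp
    rw [this]
    gcongr
    linarith
  have hgeom : ∑ j ∈ Finset.range (m + 1), (2 : ℝ) ^ j ≤ 2 * 2 ^ m := by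
    rw [geom_sum_eq (by norm_num), pow_succ]
    norm_num
    linarith
  have hsum := Finset.sum_le_sum hterm
  rw [Finset.sum_sub_distrib, ← Finset.mul_sum] at hsum
  have hw2 : 2 ^ k / c * (c * (1 + 2 / 2 ^ s))
      ≤ 2 ^ k / c * ∑ j ∈ Finset.range (m + 1), U j := by gcongr
  have hw3 : 2 ^ k / c * (c * (1 + 2 / 2 ^ s)) = (2 : ℝ) ^ k + 2 * 2 ^ m := by
    rw [hk, pow_add]; field_simp
  have hsub : ∑ j ∈ Finset.range (m + 1),
      (⌊U (k - (k + 1 - 1 - j)) * 2 ^ (k + 1 - 1 - j) / c⌋₊ : ℝ) * 2 ^ (k - (k + 1 - 1 - j)) ≤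
      ∑ j ∈ Finset.range (k + 1),
      (⌊U (k - (k + 1 - 1 - j)) * 2 ^ (k + 1 - 1 - j) / c⌋₊ : ℝ) * 2 ^ (k - (k + 1 - 1 - j)) := by
    refine Finset.sum_le_sum_of_subset_of_nonneg ?_ fun _ _ _ => by positivity
    exact Finset.range_mono (by omega)
  have : (2 : ℝ) ^ k ≤ ∑ j ∈ Finset.range (k + 1),
      (⌊U (k - (k + 1 - 1 - j)) * 2 ^ (k + 1 - 1 - j) / c⌋₊ : ℝ) * 2 ^ (k - (k + 1 - 1 - j)) := by
    linarith
  exact_mod_cast this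

/-- Splitting all leaves evenly, `t` times in a row, always leaves room for new leaves of
density `1`. -/
lemma AdmitsDensity.of_evolve (hc : 0 < c) (hcd : 2 * 2 ^ k ≤ c * d) (t : ℕ) (hU : ∀ j, 0 ≤ U j)
    (hcost : ∑ j ∈ Finset.range (k + 1), U j / 2 ^ j ≤ 2)
    (h : AdmitsDensity k d c fun j => if j < t then 1 else U (j - t)) :
    AdmitsDensity k d c U := by
  induction t generalizing U with
  | zero => simpa using h
  | succ t ih =>
    have hnext : AdmitsDensity k d c fun j => if j < 1 then 1 else U (j - 1) := by
      refine ih (fun j => ?_) ?_ ?_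
      · split_ifs
        · exact zero_le_one
        · exact hU _
      -- The fresh level costs 1 and the shifted old levels cost half as much as before.
      · rw [Finset.sum_range_succ']
        have h1 : ∑ j ∈ Finset.range k, (if j + 1 < 1 then 1 else U (j + 1 - 1)) / 2 ^ (j + 1)
            = (∑ j ∈ Finset.range k, U j / 2 ^ j) / 2 := by
          rw [Finset.sum_div]
          refine Finset.sum_congr rfl fun j _ => ?_
          rw [if_neg (by omega), Nat.add_sub_cancel, pow_succ, div_div]
        rw [Finset.sum_range_succ] at hcost
        have h2 : 0 ≤ U k / 2 ^ k := div_nonneg (hU k) (by positivity)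
        rw [h1]
        norm_num
        linarith
      · refine h.mono hc fun j => le_of_eq ?_
        split_ifs <;> first | rfl | omega
    refine AdmitsDensity.of_split hc hcd hU hcost ?_ ?_ hnext hnext fun j => ?_
    · intro j; split_ifs
      · exact zero_le_one
      · exact hU _
    · intro j; split_ifs
      · exact zero_le_one
      · exact hU _
    · simp only [Nat.add_sub_cancel, Nat.lt_one_iff, Nat.succ_ne_zero, if_false]
      linarith

/-! ### Uneven splitting -/

/-- The density `U`, moved `o` levels away from level `k`. -/
def delay (o : ℕ) (U : ℕ → ℝ) (j : ℕ) : ℝ := if j < o then 0 else U (j - o)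

lemma delay_nonneg (o : ℕ) (hU : ∀ j, 0 ≤ U j) (j : ℕ) : 0 ≤ delay o U j := by
  unfold delay
  split_ifs
  · exact le_rfl
  · exact hU _

lemma delay_mono (o : ℕ) (hUV : ∀ j, U j ≤ V j) (j : ℕ) : delay o U j ≤ delay o V j := by
  unfold delay
  split_ifs
  · exact le_rfl
  · exact hUV _

/-- Eight times the geometric tail from `j = 3` on is 2: behind three empty levels, densities up to
8 are affordable. -/
lemma cost_delay_le {o : ℕ} (ho : 3 ≤ o) (hU8 : ∀ j, U j ≤ 8) :
    ∑ j ∈ Finset.range (k + 1), delay o U j / 2 ^ j ≤ 2 := by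
  have h : ∀ m, ∑ j ∈ Finset.range m, delay o U j / 2 ^ j
      ≤ if m < 3 then 0 else 2 - 16 / 2 ^ m := by
    intro m
    induction m with
    | zero => simp
    | succ m ih =>
      rw [Finset.sum_range_succ]
      have hp : (0 : ℝ) < 2 ^ m := by positivity
      have hp' : (2 : ℝ) ^ (m + 1) = 2 ^ m * 2 := pow_succ _ _
      rcases lt_or_ge m 3 with hm | hm
      · rw [if_pos hm] at ih
        have h0 : delay o U m = 0 := if_pos (by omega)
        rw [h0, zero_div, add_zero]
        split_ifs with h1
        · exact ih
        · have : m = 2 := by omega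
          subst this
          norm_num
          exact ih
      · rw [if_neg (by omega)] at ih ⊢
        have hle : delay o U m ≤ 8 := by
          unfold delay
          split_ifs
          · norm_num
          · exact hU8 _
        have h8 : delay o U m / 2 ^ m ≤ 8 / 2 ^ m := by gcongr
        have h16 : (16 : ℝ) / 2 ^ (m + 1) = 8 / 2 ^ m := by rw [hp']; field_simp; norm_num
        have h16' : (16 : ℝ) / 2 ^ m = 2 * (8 / 2 ^ m) := by ring
        linarith
  refine (h (k + 1)).trans ?_
  split_ifs
  · norm_num
  · have : (0 : ℝ) ≤ 16 / 2 ^ (k + 1) := by positivity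
    linarith

/-- Of the `2 ^ t` descendants in generation `t`, let `a` share the leaves of one kind, and let the
other ones share the remaining leaves. -/
lemma AdmitsDensity.of_mix (hc : 0 < c) (hcd : 2 * 2 ^ k ≤ c * d)
    (hV : ∀ j, 0 ≤ V j) (hV8 : ∀ j, V j ≤ 8) (hW : ∀ j, 0 ≤ W j) (hW8 : ∀ j, W j ≤ 8)
    (t a o : ℕ) (ha : a ≤ 2 ^ t) (ho : 3 ≤ o)
    (hVa : AdmitsDensity k d c (delay (o + t) V)) (hWa : AdmitsDensity k d c (delay (o + t) W)) :
    AdmitsDensity k d c (delay o fun j => a / 2 ^ t * V j + (1 - a / 2 ^ t) * W j) := by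
  induction t generalizing a o with
  | zero =>
    interval_cases a
    · simpa using hWa
    · simpa using hVa
  | succ t ih =>
    have hmix : ∀ b : ℝ, 0 ≤ b → b ≤ 1 → ∀ j, 0 ≤ b * V j + (1 - b) * W j ∧
        b * V j + (1 - b) * W j ≤ 8 := by
      intro b hb hb1 j
      constructor
      · have := mul_nonneg hb (hV j)
        have := mul_nonneg (sub_nonneg.2 hb1) (hW j)
        linarith
      · have := mul_le_mul_of_nonneg_left (hV8 j) hb
        have := mul_le_mul_of_nonneg_left (hW8 j) (sub_nonneg.2 hb1)
        linarith
    have hfrac : ∀ (b s : ℕ), b ≤ 2 ^ s → (0 : ℝ) ≤ b / 2 ^ s ∧ (b : ℝ) / 2 ^ s ≤ 1 := by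
      intro b s hb
      refine ⟨by positivity, ?_⟩
      rw [div_le_one (by positivity)]
      exact_mod_cast hb
    -- One child takes as many of the `a` descendants as fit below it.
    obtain ⟨b₁, b₂, hb, hb₁, hb₂⟩ : ∃ b₁ b₂ : ℕ, a = b₁ + b₂ ∧ b₁ ≤ 2 ^ t ∧ b₂ ≤ 2 ^ t := by
      refine ⟨min a (2 ^ t), a - min a (2 ^ t), by omega, by omega, ?_⟩
      rw [pow_succ] at ha
      omega
    have hshift : o + (t + 1) = o + 1 + t := by omega
    rw [hshift] at hVa hWa
    have hf := hfrac a (t + 1) ha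
    have hf₁ := hfrac b₁ t hb₁
    have hf₂ := hfrac b₂ t hb₂
    refine AdmitsDensity.of_split hc hcd
      (delay_nonneg o fun j => (hmix _ hf.1 hf.2 j).1)
      (cost_delay_le ho fun j => (hmix _ hf.1 hf.2 j).2)
      (delay_nonneg (o + 1) fun j => (hmix _ hf₁.1 hf₁.2 j).1)
      (delay_nonneg (o + 1) fun j => (hmix _ hf₂.1 hf₂.2 j).1)
      (ih b₁ (o + 1) hb₁ (by omega) hVa hWa) (ih b₂ (o + 1) hb₂ (by omega) hVa hWa) fun j => ?_
    simp only [delay, Nat.add_lt_add_iff_right, Nat.add_sub_add_right]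
    split_ifs
    · norm_num
    · rw [hb, pow_succ]
      push_cast
      apply le_of_eq
      field_simp
      ring

/-! ### Densities in three blocks and the rounds -/

/-- Three blocks of `q` levels each, with densities `x`, `y`, `z` and gaps of `10` levels. -/
def blocks (q : ℕ) (x y z : ℝ) (j : ℕ) : ℝ :=
  if j < q then x else if j < q + 10 then 0 else if j < 2 * q + 10 then y else
    if j < 2 * q + 20 then 0 else if j < 3 * q + 20 then z else 0

lemma blocks_nonneg {q : ℕ} {x y z : ℝ} (hx : 0 ≤ x) (hy : 0 ≤ y) (hz : 0 ≤ z) (j : ℕ) :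
    0 ≤ blocks q x y z j := by
  unfold blocks
  split_ifs <;> first | assumption | exact le_rfl

lemma blocks_le {q : ℕ} {x y z : ℝ} (hx : x ≤ 8) (hy : y ≤ 8) (hz : z ≤ 8) (j : ℕ) :
    blocks q x y z j ≤ 8 := by
  unfold blocks
  split_ifs <;> first | assumption | norm_num

lemma sum_range_add_eq (U : ℕ → ℝ) (b v : ℝ) (a m : ℕ) (h : ∑ j ∈ Finset.range a, U j = b)
    (hU : ∀ j, a ≤ j → j < a + m → U j = v) : ∑ j ∈ Finset.range (a + m), U j = b + m * v := by
  rw [Finset.sum_range_add, h, Finset.sum_congr rfl (g := fun _ => v)]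
  · simp
  · intro j hj
    have := Finset.mem_range.1 hj
    exact hU _ (by omega) (by omega)

lemma sum_delay_blocks (o q : ℕ) (x y z : ℝ) :
    ∑ j ∈ Finset.range (o + q + 10 + q + 10 + q), delay o (blocks q x y z) j
      = q * (x + y + z) := by
  have h0 : ∑ j ∈ Finset.range o, delay o (blocks q x y z) j = 0 :=
    Finset.sum_eq_zero fun j hj => if_pos (Finset.mem_range.1 hj)
  have h1 := sum_range_add_eq _ _ x o q h0 fun j h1 h2 => by
    unfold delay blocks; split_ifs <;> first | rfl | omega
  have h2 := sum_range_add_eq _ _ 0 _ 10 h1 fun j h1 h2 => by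
    unfold delay blocks; split_ifs <;> first | rfl | omega
  have h3 := sum_range_add_eq _ _ y _ q h2 fun j h1 h2 => by
    unfold delay blocks; split_ifs <;> first | rfl | omega
  have h4 := sum_range_add_eq _ _ 0 _ 10 h3 fun j h1 h2 => by
    unfold delay blocks; split_ifs <;> first | rfl | omega
  have h5 := sum_range_add_eq _ _ z _ q h4 fun j h1 h2 => by
    unfold delay blocks; split_ifs <;> first | rfl | omega
  rw [h5]
  ring

/-- The gap 10 is the delay 3 plus the 7 levels of a mixing step. After `q + 3` further even splits,
the two old blocks have moved by exactly `q + 10`, one block and one gap. -/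
lemma delay_blocks_le (q : ℕ) {y z : ℝ} (hy : 0 ≤ y) (hz : 0 ≤ z) (j : ℕ) :
    delay 3 (blocks q 1 y z) j ≤
      if j < q + 3 then 1 else delay 10 (blocks q y z 0) (j - (q + 3)) := by
  by_cases h1 : j < q + 3
  · rw [if_pos h1]
    unfold delay
    split_ifs
    · exact zero_le_one
    · unfold blocks
      rw [if_pos (by omega)]
  · rw [if_neg h1]
    by_cases h2 : j < q + 13
    · unfold delay blocks
      rw [if_neg (by omega), if_neg (by omega), if_pos (by omega), if_pos (by omega)]
    · obtain ⟨i, rfl⟩ : ∃ i, j = q + 13 + i := ⟨j - (q + 13), by omega⟩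
      unfold delay
      rw [if_neg (by omega), if_neg (by omega), show q + 13 + i - 3 = q + 10 + i by omega,
        show q + 13 + i - (q + 3) - 10 = i by omega]
      unfold blocks
      rw [if_neg (by omega), if_neg (by omega)]
      split_ifs <;> first | exact le_rfl | omega

/-- Kraft's inequality finishes the node. With `c = 2n` and `q` about `n / 3` the densities must sum
to a little over 6; the surplus in 153/25 = 6.12 absorbs rounding and gaps. -/
lemma AdmitsDensity.of_blocks (hc : 0 < c) (hcd : 2 * 2 ^ k ≤ c * d) {q o : ℕ} {x y z : ℝ}
    (hx : 0 ≤ x) (hy : 0 ≤ y) (hz : 0 ≤ z) (hx8 : x ≤ 8) (hy8 : y ≤ 8) (hz8 : z ≤ 8)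
    (ho : 3 ≤ o) (ho' : o ≤ 10) (hk : 3 * q + 40 ≤ k) (hq : c * (1 + 1 / 128) ≤ q * (153 / 25))
    (h : 153 / 25 ≤ x + y + z) : AdmitsDensity k d c (delay o (blocks q x y z)) := by
  have hnn := delay_nonneg o (blocks_nonneg (q := q) hx hy hz)
  refine AdmitsDensity.of_weight hc hcd hnn
    (cost_delay_le ho (blocks_le hx8 hy8 hz8)) (k - 8) 8 (by omega) ?_
  calc c * (1 + 2 / 2 ^ 8) = c * (1 + 1 / 128) := by norm_num
    _ ≤ q * (x + y + z) := hq.trans (by gcongr)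
    _ = _ := (sum_delay_blocks o q x y z).symm
    _ ≤ _ := Finset.sum_le_sum_of_subset_of_nonneg (Finset.range_mono (by omega))
        fun _ _ _ => hnn _

/-- Of the 128 descendants seven levels down, `a` get the third block alone, at density at least
153/25, and `of_blocks` finishes them. The others share the first two blocks at the higher densities
`y'` and `z'`; `q + 3` even splits give them a fresh first block, and the shared ones become second
and third. -/
lemma AdmitsDensity.of_round (hc : 0 < c) (hcd : 2 * 2 ^ k ≤ c * d) {q : ℕ}
    (hk : 3 * q + 40 ≤ k) (hq : c * (1 + 1 / 128) ≤ q * (153 / 25))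
    (a : ℕ) (y' z' : ℝ) {y z : ℝ}
    (h : AdmitsDensity k d c (delay 3 (blocks q 1 y' z')))
    (ha : 0 < a) (ha' : a < 128) (hz : 153 / 25 * (a / 128) ≤ z) (hz8 : z ≤ 8 * (a / 128))
    (hy' : 0 ≤ y') (hy8' : y' ≤ 8) (hz' : 0 ≤ z') (hz8' : z' ≤ 8)
    (hy'1 : y' * (1 - a / 128) ≤ 1) (hz'y : z' * (1 - a / 128) ≤ y) :
    AdmitsDensity k d c (delay 3 (blocks q 1 y z)) := by
  have ha0 : (0 : ℝ) < a / 128 := by positivity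
  have hold : AdmitsDensity k d c (delay (3 + 7) (blocks q 0 0 (z / (a / 128)))) := by
    have h1 : 153 / 25 ≤ z / (a / 128) := by rwa [le_div_iff₀ ha0]
    have h2 : z / (a / 128) ≤ 8 := by rwa [div_le_iff₀ ha0]
    exact AdmitsDensity.of_blocks hc hcd le_rfl le_rfl (by linarith) (by norm_num) (by norm_num)
      h2 (by norm_num) (by norm_num) hk hq (by linarith)
  have hyoung : AdmitsDensity k d c (delay (3 + 7) (blocks q y' z' 0)) := by
    refine AdmitsDensity.of_evolve hc hcd (q + 3)
      (delay_nonneg _ (blocks_nonneg hy' hz' le_rfl))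
      (cost_delay_le (by norm_num) (blocks_le hy8' hz8' (by norm_num))) (h.mono hc (delay_blocks_le q hy' hz'))
  have hz0 : 0 ≤ z := le_trans (by positivity) hz
  have := AdmitsDensity.of_mix hc hcd
    (blocks_nonneg le_rfl le_rfl (div_nonneg hz0 ha0.le))
    (blocks_le (by norm_num) (by norm_num) (by rwa [div_le_iff₀ ha0]))
    (blocks_nonneg hy' hz' le_rfl) (blocks_le hy8' hz8' (by norm_num)) 7 a 3
    (by norm_num; omega) le_rfl hold hyoung
  refine this.mono hc (delay_mono 3 fun j => ?_)
  have h128 : (2 : ℝ) ^ 7 = 128 := by norm_num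
  have hcancel : (a : ℝ) / 128 * (z / (a / 128)) = z := mul_div_cancel₀ _ ha0.ne'
  rw [h128]
  unfold blocks
  split_ifs <;> linarith

lemma AdmitsDensity.zero (hc : 0 < c) (hcd : 2 * 2 ^ k ≤ c * d) {q : ℕ}
    (hk : 3 * q + 40 ≤ k) (hq : c * (1 + 1 / 128) ≤ q * (153 / 25)) :
    AdmitsDensity k d c fun _ => 0 := by
  -- The delay, three blocks and two gaps occupy `3 + 3 * q + 20` levels.
  refine AdmitsDensity.of_evolve hc hcd (3 * q + 23) (fun _ => le_rfl) (by simp) ?_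
  have hone : AdmitsDensity k d c (delay 3 (blocks q 1 1 1)) := by
    have of_round : ∀ (a : ℕ) (y' z' : ℝ) {y z : ℝ},
        AdmitsDensity k d c (delay 3 (blocks q 1 y' z')) →
        (0 < a ∧ a < 128 ∧ 153 / 25 * (a / 128) ≤ z ∧ z ≤ 8 * (a / 128) ∧
          0 ≤ y' ∧ y' ≤ 8 ∧ 0 ≤ z' ∧ z' ≤ 8 ∧
          y' * (1 - a / 128) ≤ 1 ∧ z' * (1 - a / 128) ≤ y) →
        AdmitsDensity k d c (delay 3 (blocks q 1 y z)) := by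
      rintro a y' z' y z h ⟨h1, h2, h3, h4, h5, h6, h7, h8, h9, h10⟩
      exact AdmitsDensity.of_round hc hcd hk hq a y' z' h h1 h2 h3 h4 h5 h6 h7 h8 h9 h10
    -- In each round `a` is the largest integer with `153/25 * (a/128) ≤ z`, and `y'`, `z'` are `1 /
    -- (1 - a/128)` and `y / (1 - a/128)` rounded down to multiples of 1/50. At the end 1 + 47/25 +
    -- 163/50 exceeds 153/25.
    refine of_round (20) (59/50) (59/50) ?_ (by norm_num)
    refine of_round (24) (61/50) (36/25) ?_ (by norm_num)
    refine of_round (30) (13/10) (79/50) ?_ (by norm_num)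
    refine of_round (33) (67/50) (87/50) ?_ (by norm_num)
    refine of_round (36) (69/50) (93/50) ?_ (by norm_num)
    refine of_round (38) (71/50) (49/25) ?_ (by norm_num)
    refine of_round (40) (36/25) (103/50) ?_ (by norm_num)
    refine of_round (43) (3/2) (54/25) ?_ (by norm_num)
    refine of_round (45) (77/50) (23/10) ?_ (by norm_num)
    refine of_round (48) (8/5) (123/50) ?_ (by norm_num)
    refine of_round (51) (83/50) (66/25) ?_ (by norm_num)
    refine of_round (55) (87/50) (29/10) ?_ (by norm_num)
    refine of_round (60) (47/25) (163/50) ?_ (by norm_num)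
    exact AdmitsDensity.of_blocks hc hcd (by norm_num) (by norm_num) (by norm_num) (by norm_num)
      (by norm_num) (by norm_num) le_rfl (by norm_num) hk hq (by norm_num)
  refine hone.mono hc fun j => ?_
  unfold delay blocks
  split_ifs <;> first | exact le_rfl | exact zero_le_one | omega

/-- For large `n` there is a sparse tree all of whose leaves have depth at least `n`. -/
lemma exists_isSparse {n d : ℕ} (hn : 8192 ≤ n) (hd : d * n = 2 ^ (n - 1)) :
    ∃ T : FullBinTree, T.IsSparse (n - 1) d ∧ ∀ i < n, T.leafCount i = 0 := by
  have hn0 : (8192 : ℝ) ≤ n := by exact_mod_cast hn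
  have hdR : (d : ℝ) * n = 2 ^ (n - 1) := by exact_mod_cast hd
  -- The largest `q` with `3 * q + 40 ≤ n - 1` is taken. The weight condition follows from `2.04 *
  -- (n - 43) ≥ (2 + 1/64) * n`, true from about n = 3600 on.
  have hq : (n : ℝ) - 43 ≤ 3 * ((n - 41) / 3 : ℕ) := by
    have : n ≤ 3 * ((n - 41) / 3) + 43 := by omega
    have : (n : ℝ) ≤ 3 * ((n - 41) / 3 : ℕ) + 43 := by exact_mod_cast this
    linarith
  obtain ⟨T, hT, h0⟩ := AdmitsDensity.zero (k := n - 1) (d := d) (c := 2 * n)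
    (q := (n - 41) / 3) (by linarith) (by linarith) (by omega) (by linarith)
  refine ⟨T, hT, fun i hi => ?_⟩
  have := h0 i (by omega)
  simpa using this

end FullBinTree

namespace FullBinTree

/-! ### The nodes of a tree

A node is given by the path to it from the root, the last step standing first in the list. -/

/-- The subtree below a child of the root. -/
def child (b : Bool) : FullBinTree → Option FullBinTree
  | leaf => none
  | node l r => some (if b then l else r)

/-- The subtree below the node `p`, if the tree has such a node. -/
def subtree (T : FullBinTree) : List Bool → Option FullBinTree
  | [] => some T
  | b :: p => (subtree T p).bind (child b)

/-- The nodes of the tree. -/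
def nodes (T : FullBinTree) : Set (List Bool) := {p | T.subtree p ≠ none}

lemma subtree_append (T : FullBinTree) (w v : List Bool) :
    T.subtree (w ++ v) = (T.subtree v).bind fun S => S.subtree w := by
  induction w with
  | nil => cases h : T.subtree v <;> simp [subtree, h]
  | cons b w ih => cases h : T.subtree v <;> simp_all [subtree]

lemma nil_mem_nodes (T : FullBinTree) : [] ∈ T.nodes := by simp [nodes, subtree]

lemma cons_mem_nodes {T : FullBinTree} {b : Bool} {p : List Bool} :
    b :: p ∈ T.nodes ↔ ∃ l r, T.subtree p = some (node l r) := by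
  unfold nodes
  cases h : T.subtree p with
  | none => simp [subtree, h]
  | some S => cases S <;> simp [subtree, h, child]

lemma append_mem_nodes {T : FullBinTree} {w v : List Bool} (h : w ++ v ∈ T.nodes) :
    v ∈ T.nodes := by
  intro hv
  exact h (by rw [subtree_append, hv]; rfl)

lemma subtree_eq_leaf {T : FullBinTree} {p : List Bool} (hp : p ∈ T.nodes)
    (h : true :: p ∉ T.nodes) : T.subtree p = some leaf := by
  rw [cons_mem_nodes] at h
  cases hS : T.subtree p with
  | none => exact absurd hS hp
  | some S =>
    cases S with
    | leaf => rfl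
    | node l r => exact absurd ⟨l, r, hS⟩ h

lemma subtree_node_concat (l r : FullBinTree) (w : List Bool) (b : Bool) :
    (node l r).subtree (w ++ [b]) = (if b then l else r).subtree w := by
  rw [subtree_append]
  rfl

lemma finite_nodes (T : FullBinTree) : T.nodes.Finite := by
  induction T with
  | leaf =>
    refine (Set.finite_singleton []).subset fun p hp => ?_
    rcases List.eq_nil_or_concat p with rfl | ⟨w, b, rfl⟩
    · rfl
    · rw [List.concat_eq_append] at hp
      exact absurd (by rw [subtree_append]; cases w <;> simp [subtree, child]) hp
  | node l r hl hr =>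
    refine ((Set.finite_singleton []).union
      ((hl.image fun w => w ++ [true]).union (hr.image fun w => w ++ [false]))).subset fun p hp => ?_
    rcases List.eq_nil_or_concat p with rfl | ⟨w, b, rfl⟩
    · exact Or.inl rfl
    · rw [List.concat_eq_append] at hp ⊢
      have hp : (node l r).subtree (w ++ [b]) ≠ none := hp
      rw [subtree_node_concat] at hp
      cases b
      · exact Or.inr (Or.inr ⟨w, hp, rfl⟩)
      · exact Or.inr (Or.inl ⟨w, hp, rfl⟩)

/-! ### Leaves and their number at each depth -/

/-- The leaves of the tree. -/
def leaves (T : FullBinTree) : Set (List Bool) := {p | T.subtree p = some leaf}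

lemma leaves_subset_nodes (T : FullBinTree) : T.leaves ⊆ T.nodes := fun p hp => by
  simp only [leaves, Set.mem_ofPred_eq] at hp
  simp [nodes, hp]

lemma finite_leaves (T : FullBinTree) : T.leaves.Finite :=
  T.finite_nodes.subset T.leaves_subset_nodes

lemma ncard_leaves_le (T : FullBinTree) (i : ℕ) :
    {p | p ∈ T.leaves ∧ p.length = i}.ncard ≤ T.leafCount i := by
  induction T generalizing i with
  | leaf =>
    cases i with
    | zero =>
      refine (Set.ncard_le_ncard (t := {[]}) (fun p hp => ?_) (Set.finite_singleton _)).trans ?_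
      · exact List.length_eq_zero_iff.1 hp.2
      · simp [leafCount]
    | succ i =>
      have : {p | p ∈ leaf.leaves ∧ p.length = i + 1} = ∅ := by
        refine Set.eq_empty_of_forall_notMem fun p hp => ?_
        rcases List.eq_nil_or_concat p with rfl | ⟨w, b, rfl⟩
        · simpa using hp.2
        · have h := hp.1
          rw [List.concat_eq_append] at h
          have h : leaf.subtree (w ++ [b]) = some leaf := h
          simp [subtree_append, subtree, child] at h
      simp [this]
  | node l r hl hr =>
    cases i with
    | zero =>
      have : {p | p ∈ (node l r).leaves ∧ p.length = 0} = ∅ := by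
        refine Set.eq_empty_of_forall_notMem fun p hp => ?_
        have h0 := List.length_eq_zero_iff.1 hp.2
        have h := hp.1
        simp [h0, leaves, subtree] at h
      rw [this, Set.ncard_empty]
      exact Nat.zero_le _
    | succ i =>
      have hfl : {p | p ∈ l.leaves ∧ p.length = i}.Finite := l.finite_leaves.subset fun _ h => h.1
      have hfr : {p | p ∈ r.leaves ∧ p.length = i}.Finite := r.finite_leaves.subset fun _ h => h.1
      calc {p | p ∈ (node l r).leaves ∧ p.length = i + 1}.ncard
          ≤ ((fun w => w ++ [true]) '' {p | p ∈ l.leaves ∧ p.length = i} ∪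
            (fun w => w ++ [false]) '' {p | p ∈ r.leaves ∧ p.length = i}).ncard := by
            refine Set.ncard_le_ncard (fun p hp => ?_) ((hfl.image _).union (hfr.image _))
            rcases List.eq_nil_or_concat p with rfl | ⟨w, b, rfl⟩
            · simpa using hp.2
            · rw [List.concat_eq_append] at hp ⊢
              have h1 : (node l r).subtree (w ++ [b]) = some leaf := hp.1
              have h2 : w.length = i := by simpa using hp.2
              rw [subtree_node_concat] at h1
              cases b
              · exact Or.inr ⟨w, ⟨h1, h2⟩, rfl⟩
              · exact Or.inl ⟨w, ⟨h1, h2⟩, rfl⟩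
        _ ≤ _ := (Set.ncard_union_le _ _).trans (Nat.add_le_add
            ((Set.ncard_image_le hfl).trans (hl i)) ((Set.ncard_image_le hfr).trans (hr i)))

lemma ncard_leaves_lt_le (T : FullBinTree) (m : ℕ) :
    {p | p ∈ T.leaves ∧ p.length < m}.ncard ≤ ∑ i ∈ Finset.range m, T.leafCount i := by
  induction m with
  | zero => simp
  | succ m ih =>
    rw [Finset.sum_range_succ]
    have : {p | p ∈ T.leaves ∧ p.length < m + 1} =
        {p | p ∈ T.leaves ∧ p.length < m} ∪ {p | p ∈ T.leaves ∧ p.length = m} := by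
      ext p
      simp only [Set.mem_ofPred_eq, Set.mem_union, ← and_or_left, Nat.lt_succ_iff_lt_or_eq]
    rw [this]
    exact (Set.ncard_union_le _ _).trans (Nat.add_le_add ih (T.ncard_leaves_le m))

lemma IsSparse.sum_leafCount_le {k d : ℕ} {T : FullBinTree} (h : T.IsSparse k d) :
    ∑ i ∈ Finset.range (k + 1), T.leafCount i ≤ d := by
  cases T with
  | leaf =>
    rw [Finset.sum_range_succ']
    simpa [leafCount, IsSparse] using h
  | node l r => exact h.1

lemma IsSparse.subtree {k d : ℕ} {T S : FullBinTree} (h : T.IsSparse k d) {p : List Bool}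
    (hp : T.subtree p = some S) : S.IsSparse k d := by
  induction p generalizing S with
  | nil =>
    obtain rfl : T = S := by simpa [FullBinTree.subtree] using hp
    exact h
  | cons b p ih =>
    have hp : (T.subtree p).bind (child b) = some S := hp
    obtain ⟨R, hR, hRS⟩ := Option.bind_eq_some_iff.1 hp
    cases R with
    | leaf => simp [child] at hRS
    | node l r =>
      obtain ⟨-, hl, hr⟩ := ih hR
      cases b
      · obtain rfl : r = S := by simpa [child] using hRS
        exact hr
      · obtain rfl : l = S := by simpa [child] using hRS
        exact hl

lemma length_of_mem_leaves {T : FullBinTree} {n : ℕ} (h : ∀ i < n, T.leafCount i = 0)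
    {p : List Bool} (hp : p ∈ T.leaves) : n ≤ p.length := by
  by_contra! hlt
  have h1 := T.ncard_leaves_le p.length
  rw [h _ hlt, Nat.le_zero, Set.ncard_eq_zero (T.finite_leaves.subset fun _ h => h.1)] at h1
  exact (h1 ▸ (⟨hp, rfl⟩ : p ∈ {q | q ∈ T.leaves ∧ q.length = p.length}) : p ∈ (∅ : Set _))

lemma mem_nodes_of_length_le {T : FullBinTree} {n : ℕ} (h : ∀ i < n, T.leafCount i = 0)
    (p : List Bool) (hp : p.length ≤ n) : p ∈ T.nodes := by
  induction p with
  | nil => exact T.nil_mem_nodes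
  | cons b p ih =>
    rw [List.length_cons] at hp
    rw [cons_mem_nodes]
    cases hS : T.subtree p with
    | none => exact absurd hS (ih (by omega))
    | some S =>
      cases S with
      | leaf =>
        have := length_of_mem_leaves h (p := p) hS
        omega
      | node l r => exact ⟨l, r, rfl⟩

/-! ### Hyperedges from paths, and their degrees -/

/-- The last `n` nodes on the path to `p`. -/
def lastNodes (n : ℕ) (p : List Bool) : Finset (List Bool) :=
  (Finset.range n).image fun i => p.drop i

lemma card_lastNodes {n : ℕ} {p : List Bool} (h : n ≤ p.length) : (lastNodes n p).card = n := by
  rw [lastNodes, Finset.card_image_of_injOn, Finset.card_range]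
  intro i hi j hj hij
  have hi := Finset.mem_range.1 hi
  have hj := Finset.mem_range.1 hj
  have := congrArg List.length hij
  simp only [List.length_drop] at this
  omega

lemma exists_append_of_mem_lastNodes {n : ℕ} {p v : List Bool} (h : v ∈ lastNodes n p) :
    ∃ w, p = w ++ v ∧ w.length < n := by
  obtain ⟨i, hi, rfl⟩ := Finset.mem_image.1 h
  have hi := Finset.mem_range.1 hi
  exact ⟨p.take i, (List.take_append_drop i p).symm, by rw [List.length_take]; omega⟩

/-- A leaf counted here is `w ++ v` with `w` of length at most `k`, so `w` is a leaf of the subtree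
at `v` within distance `k` of its root. -/
lemma IsSparse.ncard_leaves_below_le {k d : ℕ} {T : FullBinTree} (h : T.IsSparse k d)
    {v : List Bool} (hv : v ∈ T.nodes) :
    {p | p ∈ T.leaves ∧ v ∈ lastNodes (k + 1) p}.ncard ≤ d := by
  cases hS : T.subtree v with
  | none => exact absurd hS hv
  | some S =>
    have hfin : {p | p ∈ S.leaves ∧ p.length < k + 1}.Finite :=
      S.finite_leaves.subset fun _ h => h.1
    calc _ ≤ ((fun w => w ++ v) '' {p | p ∈ S.leaves ∧ p.length < k + 1}).ncard := by
          refine Set.ncard_le_ncard (fun p hp => ?_) (hfin.image _)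
          obtain ⟨w, rfl, hw⟩ := exists_append_of_mem_lastNodes hp.2
          have h1 : T.subtree (w ++ v) = some leaf := hp.1
          rw [subtree_append, hS] at h1
          exact ⟨w, ⟨h1, hw⟩, rfl⟩
      _ ≤ _ := (Set.ncard_image_le hfin).trans ((S.ncard_leaves_lt_le _).trans
          (h.subtree hS).sum_leafCount_le)

end FullBinTree

/-! ### The sibling pairing -/

/-- The sibling of a node of a binary tree; the root is its own sibling. -/
def sibling : List Bool → List Bool
  | [] => []
  | b :: p => (!b) :: p

lemma sibling_sibling (p : List Bool) : sibling (sibling p) = p := by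
  cases p <;> simp [sibling]

lemma sibling_eq_self {p : List Bool} (h : sibling p = p) : p = [] := by
  cases p with
  | nil => rfl
  | cons b p => simp [sibling] at h

namespace MakerBreaker

open Classical in
/-- Maker takes the root first, and then always the sibling of the vertex that Breaker has just
taken, if possible. -/
noncomputable def siblingMove (H : Hypergraph (List Bool)) (h : List (List Bool)) : List Bool :=
  if h = [] then [] else
    -- The default of `getD` is never used: in this branch a last vertex exists.
    if ∃ b, h.getLast? = some b ∧ sibling b ∉ h then sibling (h.getLast?.getD []) else
      if hv : ∃ v ∈ H.vertexSet, v ∉ h then hv.choose else []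

/-- The strategy `siblingMove` on a hypergraph whose vertices are closed under siblings. -/
noncomputable def siblingStrategy (H : Hypergraph (List Bool)) (h0 : [] ∈ H.vertexSet)
    (hs : ∀ p ∈ H.vertexSet, sibling p ∈ H.vertexSet) : MakerStrategy H where
  move := siblingMove H
  legal := by
    intro h hc _ hv
    unfold siblingMove
    split_ifs with h1 h2
    · subst h1
      exact ⟨h0, List.not_mem_nil⟩
    · obtain ⟨b, hb, hbh⟩ := h2
      rw [hb]
      exact ⟨hs b (hc.2 b (List.mem_of_getLast? hb)), hbh⟩
    · exact hv.choose_spec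

lemma siblingMove_concat (H : Hypergraph (List Bool)) {h : List (List Bool)} {b : List Bool}
    (hb : sibling b ∉ h ++ [b]) : siblingMove H (h ++ [b]) = sibling b := by
  unfold siblingMove
  rw [if_neg (by simp), if_pos ⟨b, by simp, hb⟩]
  simp

/-- After each move of Breaker, Maker answers with the sibling. -/
lemma getElem?_of_follows {H : Hypergraph (List Bool)} {h0 : [] ∈ H.vertexSet}
    {hs : ∀ p ∈ H.vertexSet, sibling p ∈ H.vertexSet} {p : List (List Bool)}
    (hp : IsCompletePlay H p) (hf : (siblingStrategy H h0 hs).Follows p) (i : ℕ) {v : List Bool}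
    (hv : p[2 * i + 1]? = some v) : p[2 * i + 2]? = some (sibling v) := by
  have hinj : ∀ {a b : ℕ} {x : List Bool}, p[a]? = some x → p[b]? = some x → a = b := by
    intro a b x ha hb
    obtain ⟨ha', rfl⟩ := List.getElem?_eq_some_iff.1 ha
    exact (List.getElem?_inj ha' hp.1.1).1 (ha.trans hb.symm)
  have hroot : p[0]? = some [] := by
    have hpos : 0 < p.length := List.length_pos_of_mem (hp.2 [] h0)
    have := hf 0 hpos
    rw [List.getElem?_eq_getElem hpos]
    simpa [siblingStrategy, siblingMove] using this
  induction i using Nat.strong_induction_on generalizing v with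
  | _ i ih =>
    have hvS : v ∈ H.vertexSet := hp.1.2 v (List.mem_of_getElem? hv)
    have hlt : 2 * i + 1 < p.length := (List.getElem?_eq_some_iff.1 hv).1
    -- Apart from the root, every earlier vertex has its sibling next to it in the play, by
    -- induction; if `sibling v` had come earlier, `v` would be claimed twice.
    have hfresh : ∀ j ≤ 2 * i + 1, p[j]? ≠ some (sibling v) := by
      intro j hj hjv
      rcases Nat.even_or_odd' j with ⟨l, rfl | rfl⟩
      · cases l with
        | zero =>
          rw [hroot, Option.some_inj] at hjv
          have : v = [] := by rw [← sibling_sibling v, ← hjv]; rfl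
          subst this
          have := hinj hroot hv
          omega
        | succ l =>
          have hl : 2 * l + 1 < p.length := by omega
          have h1 := List.getElem?_eq_getElem hl
          have h2 := ih l (by omega) h1
          rw [show 2 * (l + 1) = 2 * l + 2 by ring, h2, Option.some_inj] at hjv
          have h3 : p[2 * l + 1] = v := by
            rw [← sibling_sibling p[2 * l + 1], hjv, sibling_sibling]
          rw [h3] at h1
          have := hinj h1 hv
          omega
      · rcases Nat.lt_or_ge l i with hl | hl
        · have h2 := ih l hl hjv
          rw [sibling_sibling] at h2
          have := hinj h2 hv
          omega
        · obtain rfl : l = i := by omega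
          rw [hv, Option.some_inj] at hjv
          have := sibling_eq_self hjv.symm
          subst this
          have := hinj hroot hv
          omega
    have htake : p.take (2 * i + 2) = p.take (2 * i + 1) ++ [v] := by
      rw [List.take_add_one, hv]
      rfl
    have hnot : sibling v ∉ p.take (2 * i + 1) ++ [v] := by
      rw [← htake]
      intro hmem
      obtain ⟨j, hj⟩ := List.mem_iff_getElem?.1 hmem
      rw [List.getElem?_take] at hj
      split_ifs at hj with hj'
      exact hfresh j (by omega) hj
    have hlen : 2 * (i + 1) < p.length := by
      obtain ⟨j, hj⟩ := List.mem_iff_getElem?.1 (hp.2 _ (hs v hvS))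
      by_contra hge
      exact hfresh j (by have := (List.getElem?_eq_some_iff.1 hj).1; omega) hj
    have := hf (i + 1) hlen
    rw [show 2 * i + 2 = 2 * (i + 1) by ring] at *
    rw [List.getElem?_eq_getElem hlen, this, htake]
    exact congrArg some (siblingMove_concat H hnot)

/-- Maker wins by the sibling pairing if below every leaf of the tree there is a hyperedge on the
path to the root. -/
lemma hasWinningPairingStrategy_of_siblings (H : Hypergraph (List Bool))
    (hfin : H.vertexSet.Finite) (h0 : [] ∈ H.vertexSet)
    (hs : ∀ p ∈ H.vertexSet, sibling p ∈ H.vertexSet)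
    (he : ∀ p ∈ H.vertexSet, true :: p ∉ H.vertexSet → ∃ e ∈ H.edgeSet, ∀ v ∈ e, v <:+ p) :
    HasWinningPairingStrategy H := by
  refine ⟨siblingStrategy H h0 hs, ⟨sibling, fun v hv => ⟨hs v hv, sibling_sibling v⟩, ?_, ?_, ?_⟩,
    ?_⟩
  · simp [siblingStrategy, siblingMove, sibling]
  · rintro v ⟨-, hv, hv'⟩
    refine absurd (sibling_eq_self hv') ?_
    simpa [siblingStrategy, siblingMove] using hv
  · exact fun h b _ _ hb => siblingMove_concat H hb
  · intro p hp hf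
    have hroot : [] ∈ makerVertices p := by
      have hpos : 0 < p.length := List.length_pos_of_mem (hp.2 [] h0)
      have := hf 0 hpos
      refine ⟨0, ?_⟩
      rw [mul_zero, List.getElem?_eq_getElem hpos]
      simpa [siblingStrategy, siblingMove] using this
    have hpair : ∀ v ∈ H.vertexSet, v ∈ makerVertices p ∨ sibling v ∈ makerVertices p := by
      intro v hv
      obtain ⟨j, hj⟩ := List.mem_iff_getElem?.1 (hp.2 v hv)
      rcases Nat.even_or_odd' j with ⟨l, rfl | rfl⟩
      · exact Or.inl ⟨l, hj⟩
      · exact Or.inr ⟨l + 1, getElem?_of_follows hp hf l hj⟩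
    -- A longest path from the root owned by Maker ends in a leaf, since below any other node he
    -- owns a child.
    obtain ⟨q, ⟨hq, hqM⟩, hmax⟩ := Set.exists_max_image
      {q | q ∈ H.vertexSet ∧ ∀ v, v <:+ q → v ∈ makerVertices p} List.length
      (hfin.subset fun _ h => h.1)
      ⟨[], h0, fun v hv => by rw [List.suffix_nil.1 hv]; exact hroot⟩
    have hlong : ∀ b, b :: q ∈ H.vertexSet → b :: q ∉ makerVertices p := by
      intro b hb hbM
      have := hmax (b :: q) ⟨hb, fun v hv => by
        rcases List.suffix_cons_iff.1 hv with rfl | hv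
        · exact hbM
        · exact hqM v hv⟩
      simp at this
    have hleaf : true :: q ∉ H.vertexSet := by
      intro ht
      rcases hpair _ ht with h | h
      · exact hlong _ ht h
      · exact hlong _ (hs _ ht) h
    obtain ⟨e, heE, heq⟩ := he q hq hleaf
    exact ⟨e, heE, fun v hv => hqM v (heq v hv)⟩

end MakerBreaker

/-! ### Enlarging a uniform family to one of given maximum degree -/

lemma choose_pred_le_card_filter_mem {α : Type*} [DecidableEq α] (S : Finset α) {v : α}
    (hv : v ∈ S) (n : ℕ) :
    (S.card - 1).choose n ≤ ((S.powersetCard (n + 1)).filter (v ∈ ·)).card := by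
  rw [← Finset.card_erase_of_mem hv, ← Finset.card_powersetCard]
  refine Finset.card_le_card_of_injOn (insert v) (fun e he => ?_) fun e he f hf hef => ?_
  · have he := Finset.mem_powersetCard.1 he
    have hve : v ∉ e := fun h => Finset.notMem_erase v S (he.1 h)
    simp only [Finset.coe_filter, Finset.mem_powersetCard, Set.mem_ofPred_eq,
      Finset.mem_insert_self, and_true, Finset.card_insert_of_notMem hve, he.2]
    exact Finset.insert_subset hv (he.1.trans (Finset.erase_subset _ _))
  · have he := Finset.mem_powersetCard.1 he
    have hf := Finset.mem_powersetCard.1 hf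
    have hve : v ∉ e := fun h => Finset.notMem_erase v S (he.1 h)
    have hvf : v ∉ f := fun h => Finset.notMem_erase v S (hf.1 h)
    rw [← Finset.erase_insert hve, ← Finset.erase_insert hvf, hef]

lemma le_choose_add {m j : ℕ} (hj : 1 ≤ j) (hm : j ≤ m) : m + 1 ≤ m.choose j + j := by
  induction m, hm using Nat.le_induction with
  | base => simp [Nat.add_comm]
  | succ m hm ih =>
    obtain ⟨i, rfl⟩ : ∃ i, j = i + 1 := ⟨j - 1, by omega⟩
    rw [Nat.choose_succ_succ']
    have : 0 < m.choose i := Nat.choose_pos (by omega)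
    omega

/-- Take a largest admissible `F`. If all degrees were below `d`, any further set of `A` could be
added, as it raises degrees by at most 1; so `F = A`, against `hA`. -/
lemma exists_superset_maxDegree_eq {α : Type*} [DecidableEq α] {A E : Finset (Finset α)}
    (hE : E ⊆ A) {S : Finset α} {d : ℕ} (hEd : ∀ v ∈ S, (E.filter (v ∈ ·)).card ≤ d)
    (hA : ∃ v ∈ S, d ≤ (A.filter (v ∈ ·)).card) :
    ∃ F, E ⊆ F ∧ F ⊆ A ∧ (∀ v ∈ S, (F.filter (v ∈ ·)).card ≤ d) ∧
      ∃ v ∈ S, (F.filter (v ∈ ·)).card = d := by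
  obtain ⟨F, hF, hmax⟩ := Finset.exists_max_image
    (A.powerset.filter fun F => E ⊆ F ∧ ∀ v ∈ S, (F.filter (v ∈ ·)).card ≤ d) Finset.card
    ⟨E, by simp only [Finset.mem_filter, Finset.mem_powerset]; exact ⟨hE, subset_rfl, hEd⟩⟩
  simp only [Finset.mem_filter, Finset.mem_powerset] at hF hmax
  refine ⟨F, hF.2.1, hF.1, hF.2.2, ?_⟩
  by_contra! hne
  obtain ⟨v, hv, hvA⟩ := hA
  have hFA : ∃ e ∈ A, e ∉ F := by
    by_contra! hAF
    have : F = A := hF.1.antisymm hAF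
    exact hne v hv (le_antisymm (hF.2.2 v hv) (this ▸ hvA))
  obtain ⟨e, heA, heF⟩ := hFA
  have := hmax (insert e F) ⟨Finset.insert_subset heA hF.1,
    hF.2.1.trans (Finset.subset_insert _ _), fun w hw => by
      have h1 : (F.filter (w ∈ ·)).card < d := lt_of_le_of_ne (hF.2.2 w hw) (hne w hw)
      rw [Finset.filter_insert]
      split_ifs
      · exact (Finset.card_insert_le _ _).trans h1
      · exact h1.le⟩
  rw [Finset.card_insert_of_notMem heF] at this
  omega

/-- The hypergraph with vertex set `S` and the hyperedges `F`. -/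
def Hypergraph.ofFinset {α : Type*} (S : Finset α) (F : Finset (Finset α))
    (h : ∀ e ∈ F, e ⊆ S) : Hypergraph α where
  vertexSet := S
  edgeSet := (fun e : Finset α => (e : Set α)) '' F
  subset_vertexSet_of_mem_edgeSet' := by
    rintro _ ⟨e, he, rfl⟩
    exact_mod_cast h e he

lemma Hypergraph.degree_ofFinset {α : Type*} [DecidableEq α] (S : Finset α)
    (F : Finset (Finset α)) (h : ∀ e ∈ F, e ⊆ S) (v : α) :
    (Hypergraph.ofFinset S F h).degree v = (F.filter (v ∈ ·)).card := by
  have : {e | e ∈ (Hypergraph.ofFinset S F h).edgeSet ∧ v ∈ e} =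
      (fun e : Finset α => (e : Set α)) '' (F.filter (v ∈ ·) : Finset (Finset α)) := by
    ext e
    constructor
    · rintro ⟨⟨f, hf, rfl⟩, hv⟩
      exact ⟨f, by simpa using ⟨hf, hv⟩, rfl⟩
    · rintro ⟨f, hf, rfl⟩
      have hf := Finset.mem_filter.1 hf
      exact ⟨⟨f, hf.1, rfl⟩, hf.2⟩
  rw [Hypergraph.degree, this, Set.ncard_image_of_injective _ Finset.coe_injective,
    Set.ncard_coe_finset]

namespace FullBinTree

/-- The hypergraph of a sparse tree, with further hyperedges to make the maximum degree `d`. -/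
lemma IsSparse.exists_hypergraph {n d : ℕ} (hn : 2 ≤ n) (hd : d ≤ 2 ^ (n - 1))
    {T : FullBinTree} (hT : T.IsSparse (n - 1) d) (h0 : ∀ i < n, T.leafCount i = 0) :
    ∃ H : Hypergraph (List Bool), H.vertexSet.Finite ∧ H.IsUniform n ∧ H.HasMaxDegree d ∧
      MakerBreaker.HasWinningPairingStrategy H := by
  classical
  set S := T.finite_nodes.toFinset with hS
  have hmemS : ∀ p, p ∈ S ↔ p ∈ T.nodes := fun p => Set.Finite.mem_toFinset _
  set E := T.finite_leaves.toFinset.image (lastNodes n) with hE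
  have hEA : E ⊆ S.powersetCard n := by
    intro e he
    obtain ⟨p, hp, rfl⟩ := Finset.mem_image.1 he
    have hp := (Set.Finite.mem_toFinset _).1 hp
    refine Finset.mem_powersetCard.2 ⟨fun v hv => ?_, card_lastNodes (length_of_mem_leaves h0 hp)⟩
    obtain ⟨w, rfl, -⟩ := exists_append_of_mem_lastNodes hv
    exact (hmemS v).2 (append_mem_nodes (T.leaves_subset_nodes hp))
  have hEd : ∀ v ∈ S, (E.filter (v ∈ ·)).card ≤ d := by
    intro v hv
    have hfin : {p | p ∈ T.leaves ∧ v ∈ lastNodes n p}.Finite :=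
      T.finite_leaves.subset fun _ h => h.1
    have hle := hT.ncard_leaves_below_le ((hmemS v).1 hv)
    rw [Nat.sub_add_cancel (by omega : 1 ≤ n), Set.ncard_eq_toFinset_card _ hfin] at hle
    refine le_trans (le_trans (Finset.card_le_card fun e he => ?_)
      (Finset.card_image_le (f := lastNodes n))) hle
    obtain ⟨he, hve⟩ := Finset.mem_filter.1 he
    obtain ⟨p, hp, rfl⟩ := Finset.mem_image.1 he
    exact Finset.mem_image_of_mem _
      ((Set.Finite.mem_toFinset _).2 ⟨(Set.Finite.mem_toFinset _).1 hp, hve⟩)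
  have hroot : [] ∈ S := (hmemS _).2 T.nil_mem_nodes
  -- No leaf has depth below `n`, so all `2 ^ n` strings of length `n` are nodes.
  have hcard : 2 ^ n ≤ S.card := by
    have : Fintype.card (Fin n → Bool) = 2 ^ n := by simp
    rw [← this, ← Finset.card_univ]
    refine Finset.card_le_card_of_injOn List.ofFn (fun f _ => ?_) List.ofFn_injective.injOn
    exact (hmemS _).2 (mem_nodes_of_length_le h0 _ (by simp))
  -- The root lies in at least `|S| - (n - 1) ≥ 2 ^ n - n + 1 ≥ 2 ^ (n - 1)` of the n-subsets, so
  -- there is room to reach degree `d`.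
  have hfull : d ≤ ((S.powersetCard n).filter ([] ∈ ·)).card := by
    have h1 := choose_pred_le_card_filter_mem S hroot (n - 1)
    rw [Nat.sub_add_cancel (by omega : 1 ≤ n)] at h1
    have h2 : n - 1 < 2 ^ (n - 1) := Nat.lt_two_pow_self
    have h3 : 2 ^ n = 2 * 2 ^ (n - 1) := by
      rw [← pow_succ', Nat.sub_add_cancel (by omega : 1 ≤ n)]
    have h4 := le_choose_add (m := S.card - 1) (j := n - 1) (by omega) (by omega)
    omega
  obtain ⟨F, hEF, hFA, hFd, v, hv, hFv⟩ := exists_superset_maxDegree_eq hEA hEd ⟨[], hroot, hfull⟩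
  have hFS : ∀ e ∈ F, e ⊆ S := fun e he => (Finset.mem_powersetCard.1 (hFA he)).1
  refine ⟨Hypergraph.ofFinset S F hFS, S.finite_toSet, ?_, ⟨⟨v, hv, ?_⟩, ?_⟩, ?_⟩
  · rintro _ ⟨e, he, rfl⟩
    exact ⟨e.finite_toSet, by rw [Set.ncard_coe_finset]; exact (Finset.mem_powersetCard.1 (hFA he)).2⟩
  · rw [Hypergraph.degree_ofFinset, hFv]
  · rintro _ ⟨w, hw, rfl⟩
    rw [Hypergraph.degree_ofFinset]
    exact hFd w hw
  · refine MakerBreaker.hasWinningPairingStrategy_of_siblings _ S.finite_toSet hroot ?_ ?_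
    · intro p hp
      cases p with
      | nil => exact hp
      | cons b p => exact (hmemS _).2 (cons_mem_nodes.2 (cons_mem_nodes.1 ((hmemS _).1 hp)))
    · intro p hp hpt
      have hleaf : p ∈ T.leaves :=
        subtree_eq_leaf ((hmemS _).1 hp) fun h => hpt ((hmemS _).2 h)
      refine ⟨_, ⟨lastNodes n p, hEF (Finset.mem_image_of_mem _
        ((Set.Finite.mem_toFinset _).2 hleaf)), rfl⟩, fun v hv => ?_⟩
      obtain ⟨w, rfl, -⟩ := exists_append_of_mem_lastNodes hv
      exact List.suffix_append _ _

end FullBinTree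

theorem theorem1p2 :
    ∃ n₀ : ℕ, ∀ n : ℕ, n₀ ≤ n → (∃ k : ℕ, n = 2 ^ k) →
      ∃ (V : Type) (H : Hypergraph V),
        H.vertexSet.Finite ∧ H.IsUniform n ∧
        (∃ d : ℕ, (d : ℚ) = 2 ^ (n - 1) / (n : ℚ) ∧ H.HasMaxDegree d) ∧
        MakerBreaker.HasWinningPairingStrategy H := by
  refine ⟨8192, ?_⟩
  rintro n hn ⟨k, hk⟩
  have hkn : k ≤ n - 1 := by
    have : k < 2 ^ k := Nat.lt_two_pow_self
    omega
  have hd : 2 ^ (n - 1 - k) * n = 2 ^ (n - 1) := by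
    calc 2 ^ (n - 1 - k) * n = 2 ^ (n - 1 - k) * 2 ^ k := congrArg _ hk
      _ = 2 ^ (n - 1) := by rw [← pow_add, Nat.sub_add_cancel hkn]
  obtain ⟨T, hT, h0⟩ := FullBinTree.exists_isSparse hn hd
  obtain ⟨H, hfin, hunif, hdeg, hwin⟩ := hT.exists_hypergraph (by omega)
    (Nat.pow_le_pow_right (by norm_num) (Nat.sub_le _ _)) h0
  refine ⟨List Bool, H, hfin, hunif, ⟨2 ^ (n - 1 - k), ?_, hdeg⟩, hwin⟩
  rw [eq_div_iff (by exact_mod_cast (by omega : n ≠ 0))]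
  exact_mod_cast hd
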